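/- All graphs are finite and simple. Two distinct letters $a,b$ alternate in a word $w$ if the subword of $w$ consisting of all occurrences of $a$ and $b$ is of the form $abab\cdots$ or $baba\cdots$ (of even or odd length). A graph $G=(V,E)$ is word-representable if there is a word $w$ over $V$ such that, for all distinct $a,b\in V$, $\{a,b\}\in E$ if and only if $a$ and $b$ alternate in $w$. A melon graph is a graph that is the union of $m\ge 1$ pairwise different paths with the same two distinct endpoints $0$ and $0'$, no two of which have a vertex in common other than $0$ and $0'$. The line graph $L(G)$ of $G$ has the edges of $G$ as its vertices, two distinct edges being adjacent if and only if they share a vertex. Let $A_3$ be the triangular book graph with three pages: the graph on the vertices $0,0',1,2,3$ with the edges $\{0,0'\}$, $\{0,i\}$ and $\{0',i\}$ for $i=1,2,3$. Theorem. Let $M$ be a melon graph. The line graph $L(M)$ is word-representable if and only if $M$ does not contain $A_3$ as an induced subgraph (that is, no induced subgraph of $M$ is isomorphic to $A_3$). -/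

import Mathlib

namespace WordMelon

open Classical in
/-- The letters `a` and `b` alternate in the word `w`: the subword of `w` consisting of all the
occurrences of `a` and `b` has no two equal consecutive letters, that is, for `a ≠ b`, it is of the
form `abab⋯` or `baba⋯`, of even or odd length. -/
noncomputable def Alternate {X : Type*} (w : List X) (a b : X) : Prop :=
  (w.filter (fun c => c = a ∨ c = b)).IsChain (· ≠ ·)

/-- A graph is word-representable if there is a word `w` over its vertex set such that two distinct
vertices are adjacent if and only if they alternate in `w`. -/
def WordRepresentable {V : Type*} (G : SimpleGraph V) : Prop :=
  ∃ w : List V, ∀ a b : V, a ≠ b → (G.Adj a b ↔ Alternate w a b)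

/-- A (simple) graph `M` is a melon graph if it is the union of `m ≥ 1` paths `E 0, …, E (m - 1)`
with the same two distinct endpoints `s` and `t`, pairwise different and having no vertices in
common other than the endpoints. -/
def IsMelon {V : Type*} (M : SimpleGraph V) : Prop :=
  ∃ (s t : V) (m : ℕ) (E : Fin m → M.Walk s t),
    s ≠ t ∧ 1 ≤ m ∧
    (∀ i, (E i).IsPath) ∧
    Function.Injective E ∧
    (∀ i j, i ≠ j → ∀ x, x ∈ (E i).support → x ∈ (E j).support → x = s ∨ x = t) ∧
    (∀ x, ∃ i, x ∈ (E i).support) ∧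
    (∀ e ∈ M.edgeSet, ∃ i, e ∈ (E i).edges)

/-- The triangular book graph with `k` pages: `k` triangles sharing one edge. The vertices of the
shared edge are `Sum.inl 0` and `Sum.inl 1`; the third vertices `Sum.inr i` of the triangles are
pairwise non-adjacent. -/
def triangularBook (k : ℕ) : SimpleGraph (Fin 2 ⊕ Fin k) where
  Adj x y := x ≠ y ∧ (x.isLeft ∨ y.isLeft)
  symm := ⟨fun _ _ h => ⟨h.1.symm, h.2.symm⟩⟩
  loopless := ⟨fun _ h => h.1 rfl⟩

end WordMelon

namespace WordMelon

/-! Necessity. In a word-representable graph every vertex neighbourhood is a comparability graph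
(`WordRepresentable.exists_comparability`). If `M` contains the book, its spine is adjacent in the
line graph to the six page edges, which form two triangles joined by a matching. Transitivity forces
any two of the three matching edges into opposite directions, which is impossible
(`not_wordRepresentable_of_net`).

Sufficiency. It is enough to find an order such that, in the interval spanned by an edge, comparable
vertices are adjacent (`wordRepresentable_of_semiTransitive`). In the line graph of a melon, the
edges at `s` and those at `t` form two cliques, each ordered linearly; a path of length two links
them. Without the edge `st`, ordering both cliques by the index of the path works. The edge `st`, if
present, is put below everything, so a first and a last edge may be comparable only if they form a
path of length two. Transitivity then requires the lower of these two to be minimal in its clique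
and the upper one maximal. This can be met once in each direction, hence by two paths of length two;
a third would give the book. -/

open Classical in
/-- The letters `a` and `b` alternate in `w`, and `a` comes first: in every prefix, `a` occurs as
often as `b` or once more. -/
def AlternateFrom {X : Type*} (w : List X) (a b : X) : Prop :=
  ∀ u, u <+: w → u.count b ≤ u.count a ∧ u.count a ≤ u.count b + 1

/-! ### Alternation in terms of prefix counts -/

section Alternation

variable {X : Type*} {a b : X}

lemma alternateFrom_nil : AlternateFrom ([] : List X) a b := by
  intro u hu
  rw [List.prefix_nil] at hu
  simp [hu]

lemma alternateFrom_cons_self (hab : a ≠ b) (w : List X) :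
    AlternateFrom (a :: w) a b ↔ AlternateFrom w b a := by
  classical
  constructor
  · intro h u hu
    have := h (a :: u) (by simpa using hu)
    simp only [List.count_cons_self, List.count_cons_of_ne hab] at this
    exact ⟨by omega, by omega⟩
  · intro h u hu
    rcases u with _ | ⟨c, u⟩
    · simp
    · rw [List.cons_prefix_cons] at hu
      obtain ⟨rfl, hu⟩ := hu
      have := h u hu
      simp only [List.count_cons_self, List.count_cons_of_ne hab]
      exact ⟨by omega, by omega⟩

lemma not_alternateFrom_cons (hab : a ≠ b) (w : List X) : ¬ AlternateFrom (b :: w) a b := by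
  intro h
  have := (h [b] (by simp)).1
  simp [hab.symm] at this

lemma alternateFrom_cons_of_ne {c : X} (hca : c ≠ a) (hcb : c ≠ b) (w : List X) :
    AlternateFrom (c :: w) a b ↔ AlternateFrom w a b := by
  constructor
  · intro h u hu
    have := h (c :: u) (by simpa using hu)
    simpa [List.count_cons, hca, hcb] using this
  · intro h u hu
    rcases u with _ | ⟨d, u⟩
    · simp
    · rw [List.cons_prefix_cons] at hu
      obtain ⟨rfl, hu⟩ := hu
      simpa [List.count_cons, hca, hcb] using h u hu

-- The prepended letter is the one read last; keeping both letters general lets the induction swap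
-- their roles at each occurrence.
open Classical in
lemma isChain_cons_filter_iff (w : List X) : ∀ {a b : X}, a ≠ b →
    ((a :: w.filter (fun c => c = a ∨ c = b)).IsChain (· ≠ ·) ↔ AlternateFrom w b a) := by
  induction w with
  | nil => intro a b _; simp [alternateFrom_nil]
  | cons c w ih =>
    intro a b hab
    by_cases hca : c = a
    · subst hca
      simp [not_alternateFrom_cons hab.symm]
    by_cases hcb : c = b
    · subst hcb
      rw [alternateFrom_cons_self hab.symm, ← ih hab.symm]
      have : (fun d => decide (d = c ∨ d = a)) = fun d => decide (d = a ∨ d = c) := by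
        funext d; simp [or_comm]
      rw [this]
      simp [hab]
    · rw [alternateFrom_cons_of_ne hcb hca, ← ih hab]
      simp [hca, hcb]

open Classical in
lemma alternate_iff (hab : a ≠ b) (w : List X) :
    Alternate w a b ↔ AlternateFrom w a b ∨ AlternateFrom w b a := by
  unfold Alternate
  induction w with
  | nil => simp [alternateFrom_nil]
  | cons c w ih =>
    by_cases hca : c = a
    · subst hca
      have := isChain_cons_filter_iff w hab
      simp only [not_alternateFrom_cons hab.symm, alternateFrom_cons_self hab, or_false]
      rw [← this]
      simp
    by_cases hcb : c = b
    · subst hcb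
      have := isChain_cons_filter_iff w hab.symm
      simp only [not_alternateFrom_cons hab, alternateFrom_cons_self hab.symm, false_or]
      rw [← this]
      have : (fun d => decide (d = a ∨ d = c)) = fun d => decide (d = c ∨ d = a) := by
        funext d; simp [or_comm]
      rw [this]
      simp
    · rw [alternateFrom_cons_of_ne hcb hca, alternateFrom_cons_of_ne hca hcb, ← ih]
      simp [hca, hcb]

end Alternation

/-! ### Necessity: neighbourhoods are comparability graphs -/

/-- The neighbourhood of a vertex of a word-representable graph induces a comparability graph. -/
lemma WordRepresentable.exists_comparability {V : Type*} {G : SimpleGraph V}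
    (hG : WordRepresentable G) (c : V) :
    ∃ r : V → V → Prop, (∀ x y z, r x y → r y z → r x z) ∧
      ∀ a b, a ≠ b → G.Adj c a → G.Adj c b → (G.Adj a b ↔ r a b ∨ r b a) := by
  classical
  obtain ⟨w, hw⟩ := hG
  -- For a neighbour `x` of `c` the shift makes `g x` take values 0 and 1 only. Two neighbours
  -- alternate exactly when these functions on prefixes are pointwise comparable.
  let g : V → List V → ℤ := fun x u =>
    u.count x - u.count c + (if AlternateFrom w x c then 0 else 1)
  refine ⟨fun x y => ∀ u, u <+: w → g x u ≤ g y u,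
    fun x y z hxy hyz u hu => (hxy u hu).trans (hyz u hu), fun a b hab hca hcb => ?_⟩
  rw [hw a b hab, alternate_iff hab]
  have key : ∀ {x}, G.Adj c x → AlternateFrom w x c ∨ AlternateFrom w c x := fun {x} h =>
    (alternate_iff h.ne.symm w).1 ((hw x c h.ne.symm).1 h.symm)
  have key' : ∀ {x}, G.Adj c x → ∀ u, u <+: w →
      ((AlternateFrom w x c) → u.count c ≤ u.count x ∧ u.count x ≤ u.count c + 1) ∧
      (¬ (AlternateFrom w x c) → u.count x ≤ u.count c ∧ u.count c ≤ u.count x + 1) := by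
    intro x hx u hu
    refine ⟨fun h => ?_, fun h => ?_⟩
    · convert h u hu
    · convert (key hx).resolve_left h u hu
  have forward : ∀ {x y : V}, G.Adj c x → G.Adj c y → AlternateFrom w x y →
      (∀ u, u <+: w → g x u ≤ g y u) ∨ (∀ u, u <+: w → g y u ≤ g x u) := by
    intro x y hx hy h
    have h' : ∀ u, u <+: w → u.count y ≤ u.count x ∧ u.count x ≤ u.count y + 1 := by
      intro u hu; convert h u hu
    by_cases h1 : AlternateFrom w x c <;> by_cases h2 : AlternateFrom w y c
    · right; intro u hu; have := h' u hu; simp only [g, h1, h2, if_true]; omega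
    · left; intro u hu; have := h' u hu; simp only [g, h1, h2, if_true, if_false]; omega
    · right; intro u hu; have := h' u hu; simp only [g, h1, h2, if_true, if_false]; omega
    · right; intro u hu; have := h' u hu; simp only [g, h1, h2, if_false]; omega
  have backward : ∀ {x y : V}, G.Adj c x → G.Adj c y →
      (∀ u, u <+: w → g x u ≤ g y u) → AlternateFrom w x y ∨ AlternateFrom w y x := by
    intro x y hx hy h
    have hx' := key' hx
    have hy' := key' hy
    by_cases h1 : AlternateFrom w x c <;> by_cases h2 : AlternateFrom w y c
    · right; intro u hu
      have h3 := (hx' u hu).1 h1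
      have h4 := (hy' u hu).1 h2
      have h5 := h u hu
      simp only [g, h1, h2, if_true] at h5
      convert (by omega : u.count x ≤ u.count y ∧ u.count y ≤ u.count x + 1)
    · left; intro u hu
      have h3 := (hx' u hu).1 h1
      have h4 := (hy' u hu).2 h2
      have h5 := h u hu
      simp only [g, h1, h2, if_true, if_false] at h5
      convert (by omega : u.count y ≤ u.count x ∧ u.count x ≤ u.count y + 1)
    -- The empty prefix already gives `g x = 1` and `g y = 0`.
    · have := h [] (by simp)
      simp [g, h1, h2] at this
    · right; intro u hu
      have h3 := (hx' u hu).2 h1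
      have h4 := (hy' u hu).2 h2
      have h5 := h u hu
      simp only [g, h1, h2, if_false] at h5
      convert (by omega : u.count x ≤ u.count y ∧ u.count y ≤ u.count x + 1)
  constructor
  · rintro (h | h)
    · exact forward hca hcb h
    · exact (forward hcb hca h).symm
  · rintro (h | h)
    · exact backward hca hcb h
    · exact (backward hcb hca h).symm

/-- If a vertex `c` is adjacent to all the vertices of a triangle `a` and to the other ends of three
pendant edges `a i`, `b i`, then the graph is not word-representable. -/
lemma not_wordRepresentable_of_net {V : Type*} {G : SimpleGraph V} (c : V) (a b : Fin 3 → V)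
    (hca : ∀ i, G.Adj c (a i)) (hcb : ∀ i, G.Adj c (b i))
    (haa : ∀ i j, i ≠ j → G.Adj (a i) (a j))
    (hab : ∀ i j, a i ≠ b j ∧ (G.Adj (a i) (b j) ↔ i = j)) : ¬ WordRepresentable G := by
  intro hG
  obtain ⟨r, htr, hr⟩ := hG.exists_comparability c
  have haa' : ∀ i j, i ≠ j → r (a i) (a j) ∨ r (a j) (a i) := fun i j h =>
    (hr _ _ (haa i j h).ne (hca i) (hca j)).1 (haa i j h)
  have hab' : ∀ i j, (r (a i) (b j) ∨ r (b j) (a i)) ↔ i = j := fun i j =>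
    (hr _ _ (hab i j).1 (hca i) (hcb j)).symm.trans (hab i j).2
  -- Otherwise `b i`, `a i`, `a j` would be a chain, making `b i` and `a j` comparable.
  have up : ∀ i j, i ≠ j → r (a i) (a j) → r (a i) (b i) := fun i j hij h =>
    ((hab' i i).2 rfl).resolve_right fun h' =>
      hij.symm ((hab' j i).1 (Or.inr (htr _ _ _ h' h)))
  have down : ∀ i j, i ≠ j → r (a j) (a i) → ¬ r (a i) (b i) := fun i j hij h h' =>
    hij.symm ((hab' j i).1 (Or.inl (htr _ _ _ h h')))
  have split : ∀ i j, i ≠ j →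
      r (a i) (b i) ∧ ¬ r (a j) (b j) ∨ r (a j) (b j) ∧ ¬ r (a i) (b i) := by
    intro i j hij
    rcases haa' i j hij with h | h
    · exact Or.inl ⟨up i j hij h, down j i hij.symm h⟩
    · exact Or.inr ⟨up j i hij.symm h, down i j hij h⟩
  have h01 := split 0 1 (by decide)
  have h02 := split 0 2 (by decide)
  have h12 := split 1 2 (by decide)
  clear split up down hab' haa' hab hr
  -- Three truth values cannot be pairwise different.
  tauto

lemma triangularBook_adj {k : ℕ} (x y : Fin 2 ⊕ Fin k) :
    (triangularBook k).Adj x y ↔ x ≠ y ∧ (x.isLeft ∨ y.isLeft) := Iff.rfl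

/-- The line graph of a graph with an induced book of three triangles is not
word-representable. -/
theorem not_wordRepresentable_lineGraph {V : Type*} {M : SimpleGraph V}
    (h : (triangularBook 3).IsIndContained M) : ¬ WordRepresentable M.lineGraph := by
  obtain ⟨f⟩ := h
  have hc : M.Adj (f (.inl 0)) (f (.inl 1)) := by
    rw [f.map_adj_iff, triangularBook_adj]; simp
  have ha : ∀ i, M.Adj (f (.inl 0)) (f (.inr i)) := fun i => by
    rw [f.map_adj_iff, triangularBook_adj]; simp
  have hb : ∀ i, M.Adj (f (.inl 1)) (f (.inr i)) := fun i => by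
    rw [f.map_adj_iff, triangularBook_adj]; simp
  have hf : ∀ x y, f x = f y ↔ x = y := fun x y => f.injective.eq_iff
  refine not_wordRepresentable_of_net (G := M.lineGraph) ⟨s(_, _), hc⟩ (fun i => ⟨s(_, _), ha i⟩)
    (fun i => ⟨s(_, _), hb i⟩) ?_ ?_ ?_ ?_ <;> intro i
  all_goals try intro j
  all_goals simp [SimpleGraph.lineGraph_adj_iff_exists, hf]
  all_goals grind

/-! ### Sufficiency: words from semi-transitive orientations -/

section Blocks

variable {V : Type*}

lemma Alternate.of_infix {w w' : List V} {a b : V} (h : Alternate w a b)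
    (hw : w' <:+: w) : Alternate w' a b :=
  List.IsChain.infix h (hw.filter _)

open Classical in
lemma alternate_comm {w : List V} {a b : V} : Alternate w a b ↔ Alternate w b a := by
  unfold Alternate
  have : (fun c => decide (c = a ∨ c = b)) = fun c => decide (c = b ∨ c = a) := by
    funext c; simp [or_comm]
  rw [this]

open Classical in
/-- A word in which each letter of `σ` occurs twice. The first occurrences outside `F` come after
the second occurrences outside `Y`. -/
noncomputable def block (σ : List V) (F Y : V → Prop) : List V :=
  σ.filter (fun z => F z) ++ σ.filter (fun z => ¬ Y z) ++
    (σ.filter (fun z => ¬ F z) ++ σ.filter (fun z => Y z))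

variable {σ : List V} {F Y : V → Prop} {u v : V}

open Classical in
lemma filter_block {l : List V} (hσ : σ.filter (fun c => c = u ∨ c = v) = l) :
    (block σ F Y).filter (fun c => c = u ∨ c = v) = block l F Y := by
  simp only [block, List.filter_append, List.filter_comm (fun c => decide (c = u ∨ c = v)), hσ]

open Classical in
lemma filter_block_eq (hσ : σ.filter (fun c => c = u ∨ c = v) = [u, v])
    (hF : F v → F u) (hY : Y u → Y v) (hFY : F v ∨ Y u) :
    (block σ F Y).filter (fun c => c = u ∨ c = v) = [u, v, u, v] := by
  rw [filter_block hσ]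
  by_cases h1 : F u <;> by_cases h2 : F v <;> by_cases h3 : Y u <;> by_cases h4 : Y v <;>
    simp_all [block]

-- Restricted to the two letters, the block starts with `uu` if `Y u` fails, and is `uvvu`
-- otherwise.
open Classical in
lemma not_alternate_block {l : List V} (hσ : σ.filter (fun c => c = u ∨ c = v) = l)
    (hl : l = [u, v] ∨ l = [v, u]) (hu : F u) (hv : ¬ F v) (hv' : Y v)
    (h : Y u → l = [v, u]) : ¬ Alternate (block σ F Y) u v := by
  unfold Alternate
  rw [filter_block hσ]
  by_cases h3 : Y u
  · simp [h h3, block, h3, hv', hu, hv]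
  · rcases hl with rfl | rfl <;> simp [block, h3, hv', hu, hv]

-- Each piece ends in `v` and the next one starts with `u`, so the junctions do no harm; the
-- induction also records the first letter.
open Classical in
lemma alternate_flatMap {ι : Type*} (huv : u ≠ v) (l : List ι) (f : ι → List V)
    (h : ∀ e, (f e).filter (fun c => c = u ∨ c = v) = [u, v, u, v]) :
    Alternate (l.flatMap f) u v := by
  have key : ((l.flatMap f).filter (fun c => c = u ∨ c = v)).IsChain (· ≠ ·) ∧
      ∀ x ∈ ((l.flatMap f).filter (fun c => c = u ∨ c = v)).head?, x = u := by
    induction l with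
    | nil => simp
    | cons e l ih =>
      rw [List.flatMap_cons, List.filter_append, h]
      refine ⟨List.isChain_append.2 ⟨by simp [huv, huv.symm], ih.1, ?_⟩, by simp⟩
      intro x hx y hy
      rw [ih.2 y hy]
      simp at hx
      rw [← hx]
      exact huv.symm
  exact key.1

end Blocks

open Classical in
lemma exists_linearExtension {V : Type*} [Finite V] (lt : V → V → Prop) [IsStrictOrder V lt] :
    ∃ (σ : List V) (s : V → V → Prop), (∀ x, x ∈ σ) ∧ (∀ x y, s x y ∨ s y x) ∧
      (∀ x y, lt x y → s x y) ∧
      ∀ x y, x ≠ y → s x y → σ.filter (fun c => c = x ∨ c = y) = [x, y] := by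
  have := Fintype.ofFinite V
  let _ := partialOrderOfSO lt
  obtain ⟨s, hs, hle⟩ := extend_partialOrder (fun x y : V => x ≤ y)
  refine ⟨Finset.univ.sort s, s, by simp, hs.total, fun x y h => hle _ _ (le_of_lt h), ?_⟩
  intro x y hxy h
  have hp : (Finset.univ.sort s).Pairwise s := Finset.pairwise_sort _ _
  refine List.Perm.eq_of_pairwise (le := s) (fun a b _ _ h1 h2 => hs.antisymm _ _ h1 h2)
    (hp.filter _) (by simp [h]) ?_
  rw [List.perm_ext_iff_of_nodup ((Finset.sort_nodup _ _).filter _) (by simp [hxy])]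
  simp

/-- A graph that has a semi-transitive orientation, given here by a partial order in which adjacent
vertices are comparable, is word-representable. -/
theorem wordRepresentable_of_semiTransitive {V : Type*} [Finite V] (G : SimpleGraph V)
    (lt : V → V → Prop) [IsStrictOrder V lt] (hadj : ∀ u v, G.Adj u v → lt u v ∨ lt v u)
    (h : ∀ u v x y, G.Adj u v → lt u v → (u = x ∨ lt u x) → lt x y → (y = v ∨ lt y v) →
      G.Adj x y) : WordRepresentable G := by
  classical
  obtain ⟨σ, s, hσ, hs, hlt, hfil⟩ := exists_linearExtension lt
  have tr : ∀ {x y z}, lt x y → lt y z → lt x z := fun h1 h2 => _root_.trans h1 h2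
  have irr : ∀ x, ¬ lt x x := fun x => irrefl x
  -- The block of `e` has to break the alternation of `e` with non-neighbours. `F e` is the
  -- complement of the up-set of `e`; `Y e` enlarges that up-set just enough for every edge to read
  -- `uvuv` in every block.
  let F : V → V → Prop := fun e z => ¬ (e = z ∨ lt e z)
  let Y : V → V → Prop := fun e z => (e = z ∨ lt e z) ∨
    ∃ u v, G.Adj u v ∧ lt u v ∧ (u = z ∨ lt u z) ∧ (e = v ∨ lt e v)
  let B : V → List V := fun e => block σ (F e) (Y e)
  have edge : ∀ u v, G.Adj u v → lt u v → Alternate (σ.flatMap B) u v := by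
    intro u v huv hl
    refine alternate_flatMap huv.ne _ _ fun e => filter_block_eq (hfil _ _ huv.ne (hlt _ _ hl))
      ?_ ?_ ?_
    · rintro h1 (rfl | h2)
      · exact h1 (Or.inr hl)
      · exact h1 (Or.inr (tr h2 hl))
    · rintro ((rfl | h2) | ⟨u', v', h1, h2, h3, h4⟩)
      · exact Or.inl (Or.inr hl)
      · exact Or.inl (Or.inr (tr h2 hl))
      · refine Or.inr ⟨u', v', h1, h2, ?_, h4⟩
        rcases h3 with rfl | h3
        · exact Or.inr hl
        · exact Or.inr (tr h3 hl)
    · by_cases hv : e = v ∨ lt e v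
      · exact Or.inr (Or.inr ⟨u, v, huv, hl, Or.inl rfl, hv⟩)
      · exact Or.inl hv
  have infx : ∀ e, B e <:+: σ.flatMap B := by
    intro e
    obtain ⟨l₁, l₂, hl⟩ := List.append_of_mem (hσ e)
    exact ⟨l₁.flatMap B, l₂.flatMap B, by rw [hl]; simp⟩
  -- The block of `y` separates `x` from `y`. If `x` is below `y`, semi-transitivity keeps `x` out
  -- of `Y y`; if they are incomparable, `y` is taken to be the earlier one in `σ`.
  have nonedge : ∀ x y, x ≠ y → ¬ G.Adj x y → ¬ lt y x → (lt x y ∨ s y x) →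
      ¬ Alternate (σ.flatMap B) x y := by
    intro x y hxy hna hyx hor hal
    have hal' := hal.of_infix (infx y)
    have hc : ∀ x y : V, σ.filter (fun c => c = x ∨ c = y) = σ.filter (fun c => c = y ∨ c = x) :=
      fun x y => by simp only [or_comm]
    refine not_alternate_block rfl ?_ ?_ ?_ ?_ ?_ hal'
    · rcases hs x y with h1 | h1
      · exact Or.inl (hfil _ _ hxy h1)
      · exact Or.inr (by rw [hc, hfil _ _ hxy.symm h1])
    · rintro (rfl | h1)
      exacts [hxy rfl, hyx h1]
    · exact fun h1 => h1 (Or.inl rfl)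
    · exact Or.inl (Or.inl rfl)
    · intro hY
      rcases hor with hor | hor
      · rcases hY with (rfl | h1) | ⟨u, v, h1, h2, h3, h4⟩
        · exact absurd rfl hxy
        · exact absurd h1 hyx
        · exact absurd (h u v x y h1 h2 h3 hor h4) hna
      · rw [hc, hfil _ _ hxy.symm hor]
  refine ⟨σ.flatMap B, fun a b hab => ⟨fun hG => ?_, fun hal => ?_⟩⟩
  · rcases hadj a b hG with h1 | h1
    · exact edge a b hG h1
    · exact alternate_comm.1 (edge b a hG.symm h1)
  · by_contra hna
    have hna' : ¬ G.Adj b a := fun h1 => hna h1.symm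
    by_cases h1 : lt a b
    · exact nonedge a b hab hna (fun h2 => irr _ (tr h1 h2)) (Or.inl h1) hal
    by_cases h2 : lt b a
    · exact nonedge b a hab.symm hna' h1 (Or.inl h2) (alternate_comm.1 hal)
    rcases hs a b with h3 | h3
    · exact nonedge b a hab.symm hna' h1 (Or.inr h3) (alternate_comm.1 hal)
    · exact nonedge a b hab hna h2 (Or.inr h3) hal

/-! ### An orientation of the line graph in terms of edge labels -/

/-- The position of an edge in a union of paths with common ends: the only edge of a path, the first
or the last edge of the path `i` of length at least two, or the edge number `j` of the path `i`,
where `0 < j` and `j + 1` is less than the length. -/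
inductive EdgeLabel (I : Type*)
  | only
  | first (i : I)
  | last (i : I)
  | inner (i : I) (j : ℕ)

/-- Linear orders `α` of the first edges and `β` of the last edges of paths of lengths `n i`,
together with the order relations `AB` and `BA` between first and last edges, that make up a
semi-transitive orientation of the line graph. -/
structure PathOrder {I : Type*} (n : I → ℕ) (hasOnly : Prop) where
  α : I → ℤ
  β : I → ℤ
  AB : I → I → Prop
  BA : I → I → Prop
  α_inj : ∀ i j, α i = α j → i = j
  β_inj : ∀ i j, β i = β j → i = j
  α_AB : ∀ i j k, α i < α j → AB j k → AB i k
  AB_β : ∀ i j k, AB i j → β j < β k → AB i k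
  β_BA : ∀ i j k, β i < β j → BA j k → BA i k
  BA_α : ∀ i j k, BA i j → α j < α k → BA i k
  AB_BA : ∀ i j k, AB i j → ¬ BA j k
  BA_AB : ∀ i j k, BA i j → ¬ AB j k
  two : ∀ i, n i = 2 → AB i i ∨ BA i i
  AB_self : ∀ i, AB i i → n i = 2
  BA_self : ∀ i, BA i i → n i = 2
  AB_inner : ∀ i j k, AB i j → β j ≤ β k → 3 ≤ n k → α i ≤ α k
  BA_inner : ∀ i j k, BA i j → α j ≤ α k → 3 ≤ n k → False
  AB_anti : ∀ i k, AB i i → α i < α k → ¬ AB k i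
  AB_anti' : ∀ i k, AB i i → AB i k → ¬ β k < β i
  BA_anti : ∀ i k, BA i i → β i < β k → ¬ BA k i
  BA_anti' : ∀ i k, BA i i → BA i k → ¬ α k < α i
  -- The edge `only` is below all others and meets every first and last edge, so comparable pairs in
  -- between have to meet.
  only_AB : hasOnly → ∀ i j, AB i j → i = j
  only_BA : hasOnly → ∀ i j, BA i j → i = j

namespace EdgeLabel

variable {I : Type*} (n : I → ℕ)

/-- The labels that occur for paths of lengths `n i`. -/
def Valid (hasOnly : Prop) : EdgeLabel I → Prop
  | only => hasOnly
  | first i => 2 ≤ n i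
  | last i => 2 ≤ n i
  | inner i j => 1 ≤ j ∧ j + 2 ≤ n i

/-- Edges with these labels share a vertex. -/
def Meet : EdgeLabel I → EdgeLabel I → Prop
  | only, only => True
  | only, first _ => True
  | only, last _ => True
  | only, inner _ _ => False
  | first _, only => True
  | first _, first _ => True
  | first i, last j => i = j ∧ n i = 2
  | first i, inner k j => i = k ∧ j = 1
  | last _, only => True
  | last i, first j => i = j ∧ n i = 2
  | last _, last _ => True
  | last i, inner k j => i = k ∧ j + 2 = n k
  | inner _ _, only => False
  | inner i j, first k => i = k ∧ j = 1
  | inner i j, last k => i = k ∧ j + 2 = n k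
  | inner i j, inner k l => i = k ∧ (j = l ∨ j + 1 = l ∨ l + 1 = j)

variable {n} {p : Prop} (P : PathOrder n p)

/-- The order of a semi-transitive orientation. -/
def Lt : EdgeLabel I → EdgeLabel I → Prop
  | only, only => False
  | only, _ => True
  | first i, first j => P.α i < P.α j
  | first i, last j => P.AB i j
  | first i, inner k _ => P.α i ≤ P.α k
  | last i, first j => P.BA i j
  | last i, last j => P.β i < P.β j
  -- Along a path the order increases from the first edge to the final inner edge, which is also
  -- above the last edge and hence maximal.
  | last i, inner k j => P.β i ≤ P.β k ∧ j + 2 = n k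
  | inner i j, inner k l => i = k ∧ j < l
  | _, _ => False

lemma lt_irrefl (x : EdgeLabel I) : ¬ Lt P x x := by
  cases x <;> simp [Lt]

lemma lt_trans {x y z : EdgeLabel I} (hz : Valid n p z) (hxy : Lt P x y)
    (hyz : Lt P y z) : Lt P x z := by
  cases x <;> cases y <;> try exact hxy.elim
  all_goals cases z <;> try exact hyz.elim
  all_goals simp only [Lt, Valid] at *
  · exact hxy.trans hyz
  · exact P.α_AB _ _ _ hxy hyz
  · exact hxy.le.trans hyz
  · exact (P.AB_BA _ _ _ hxy hyz).elim
  · exact P.AB_β _ _ _ hxy hyz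
  · exact P.AB_inner _ _ _ hxy hyz.1 (by omega)
  · obtain ⟨rfl, -⟩ := hyz; exact hxy
  · exact P.BA_α _ _ _ hxy hyz
  · exact (P.BA_AB _ _ _ hxy hyz).elim
  · exact (P.BA_inner _ _ _ hxy hyz (by omega)).elim
  · exact P.β_BA _ _ _ hxy hyz
  · exact hxy.trans hyz
  · exact ⟨hxy.le.trans hyz.1, hyz.2⟩
  · obtain ⟨rfl, hyz⟩ := hyz; omega
  · obtain ⟨rfl, hxy⟩ := hxy; obtain ⟨rfl, hyz⟩ := hyz; exact ⟨rfl, by omega⟩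

lemma lt_or_lt {x y : EdgeLabel I} (hxy : x ≠ y) (h : Meet n x y) : Lt P x y ∨ Lt P y x := by
  have h1 : ∀ i j, i ≠ j → P.α i < P.α j ∨ P.α j < P.α i := fun i j hij =>
    lt_or_gt_of_ne fun h => hij (P.α_inj _ _ h)
  have h2 : ∀ i j, i ≠ j → P.β i < P.β j ∨ P.β j < P.β i := fun i j hij =>
    lt_or_gt_of_ne fun h => hij (P.β_inj _ _ h)
  have h3 := P.two
  cases x <;> cases y <;> simp only [Lt, Meet, ne_eq, first.injEq, last.injEq, inner.injEq] at * <;>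
    first | exact h1 _ _ hxy | exact h2 _ _ hxy | grind

lemma meet_of_between {u v x y : EdgeLabel I} (hu : Valid n p u) (hv : Valid n p v)
    (hx : Valid n p x) (hy : Valid n p y) (huv : Meet n u v) (hlt : Lt P u v)
    (hux : u = x ∨ Lt P u x) (hxy : Lt P x y) (hyv : y = v ∨ Lt P y v) : Meet n x y := by
  have h1 : ∀ i j, P.α i = P.α j ↔ i = j := fun i j => ⟨P.α_inj i j, fun h => h ▸ rfl⟩
  have h2 : ∀ i j, P.β i = P.β j ↔ i = j := fun i j => ⟨P.β_inj i j, fun h => h ▸ rfl⟩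
  have h3 : ∀ {i j k}, P.α i ≤ P.α j → P.AB j k → P.AB i k := fun {i j k} h h' => by
    rcases h.lt_or_eq with h | h
    exacts [P.α_AB _ _ _ h h', (h1 _ _).1 h ▸ h']
  have h4 : ∀ {i j k}, P.AB i j → P.β j ≤ P.β k → P.AB i k := fun {i j k} h' h => by
    rcases h.lt_or_eq with h | h
    exacts [P.AB_β _ _ _ h' h, (h2 _ _).1 h ▸ h']
  have h5 := P.AB_BA
  have h6 := P.BA_AB
  have h7 := P.AB_self
  have h8 := P.BA_self
  cases u <;> cases v <;> (try exact hlt.elim) <;> (try exact huv.elim)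
  all_goals cases x <;> (try (rcases hux with hux | hux <;> [cases hux; exact hux.elim]))
  all_goals cases y <;> (try (rcases hyv with hyv | hyv <;> [cases hyv; exact hyv.elim])) <;>
    (try exact hxy.elim)
  all_goals (try trivial)
  all_goals simp only [Lt, Meet, Valid, reduceCtorEq, false_or, first.injEq, last.injEq,
    inner.injEq] at *
  all_goals try grind only [P.AB_inner, P.BA_inner, P.AB_anti, P.AB_anti', P.BA_anti,
    P.BA_anti', P.only_AB, P.only_BA]
  -- In the cases left, one of `x`, `y` is a first edge and the other a last edge: either they are
  -- the two edges of the same path of length two, or the case is contradictory.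
  · obtain ⟨rfl, hn⟩ := huv
    have h9 := h4 hxy (hyv.elim (fun h => h ▸ le_rfl) le_of_lt)
    obtain rfl := hux.resolve_right fun h => P.AB_anti _ _ hlt h h9
    exact ⟨(hyv.resolve_right fun h => P.AB_anti' _ _ hlt hxy h).symm, hn⟩
  · obtain ⟨rfl, hn⟩ := huv
    have h9 := P.AB_inner _ _ _ hxy hyv.1 (by omega)
    obtain rfl := hux.resolve_right fun h => h9.not_gt h
    have h10 := h7 _ (h4 hxy hyv.1)
    omega
  · obtain ⟨rfl, hn⟩ := huv
    have h9 : P.BA _ _ := hyv.elim (fun h => h ▸ hxy) (P.BA_α _ _ _ hxy)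
    obtain rfl := hux.resolve_right fun h => P.BA_anti _ _ hlt h h9
    exact ⟨(hyv.resolve_right fun h => P.BA_anti' _ _ hlt hxy h).symm, hn⟩
  · obtain ⟨rfl, hn⟩ := huv
    exact (P.BA_inner _ _ _ hxy hyv (by omega)).elim

/-- A graph whose vertices are labelled such that adjacency is read off from the labels is
word-representable. -/
theorem wordRepresentable (P : PathOrder n p) {W : Type*} [Finite W] {G : SimpleGraph W}
    (f : W → EdgeLabel I) (hf : Function.Injective f) (hv : ∀ e, Valid n p (f e))
    (hG : ∀ e e', e ≠ e' → (G.Adj e e' ↔ Meet n (f e) (f e'))) : WordRepresentable G := by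
  let lt : W → W → Prop := fun e e' => Lt P (f e) (f e')
  have : IsStrictOrder W lt :=
    { irrefl := fun e => lt_irrefl P (f e)
      trans := fun e e' e'' h h' => lt_trans P (hv e'') h h' }
  refine wordRepresentable_of_semiTransitive G lt
    (fun u v h => lt_or_lt P (hf.ne h.ne) ((hG u v h.ne).1 h)) fun u v x y h hl hux hxy hyv => ?_
  have hne : x ≠ y := by
    rintro rfl
    exact lt_irrefl P _ hxy
  exact (hG x y hne).2 (meet_of_between P (hv u) (hv v) (hv x) (hv y) ((hG u v h.ne).1 h) hl
    (hux.imp_left (congrArg f)) hxy (hyv.imp_left (congrArg f)))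

end EdgeLabel

/-! ### The two choices of orders -/

/-- The orders for paths of length at least two. -/
def PathOrder.ofNotOnly {m : ℕ} (n : Fin m → ℕ) : PathOrder n False where
  α i := i
  β i := i
  AB i j := i < j ∨ i = j ∧ n i = 2
  BA _ _ := False
  α_inj := by grind
  β_inj := by grind
  α_AB := by grind
  AB_β := by grind
  β_BA := by grind
  BA_α := by grind
  AB_BA := by grind
  BA_AB := by grind
  two := by grind
  AB_self := by grind
  BA_self := by grind
  AB_inner := by grind
  BA_inner := by grind
  AB_anti := by grind
  AB_anti' := by grind
  BA_anti := by grind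
  BA_anti' := by grind
  only_AB := by grind
  only_BA := by grind

open Classical in
/-- The orders when at most two paths have length two: one that satisfies `Q` and one that
satisfies `R`. -/
noncomputable def PathOrder.ofTwo {m : ℕ} (n : Fin m → ℕ) (Q R : Fin m → Prop)
    (hQ : ∀ i j, Q i → Q j → i = j) (hR : ∀ i j, R i → R j → i = j) (hQR : ∀ i, Q i → ¬ R i)
    (hn : ∀ i, n i = 2 ↔ Q i ∨ R i) : PathOrder n True where
  -- The values -1 and `m` lie outside the indices `0, …, m - 1`: the `Q` path has the least first
  -- and greatest last edge, the `R` path the greatest first and least last edge.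
  α i := if Q i then -1 else if R i then m else i
  β i := if Q i then 1 else if R i then -m else -i
  AB i j := i = j ∧ Q i
  BA i j := i = j ∧ R i
  α_inj := by grind
  β_inj := by grind
  α_AB := by grind
  AB_β := by grind
  β_BA := by grind
  BA_α := by grind
  AB_BA := by grind
  BA_AB := by grind
  two := by grind
  AB_self := by grind
  BA_self := by grind
  AB_inner := by grind
  BA_inner := by grind
  AB_anti := by grind
  AB_anti' := by grind
  BA_anti := by grind
  BA_anti' := by grind
  only_AB := by grind
  only_BA := by grind

open SimpleGraph

/-! ### Labelling the edges of a melon graph -/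

section Melon

variable {V : Type*} {M : SimpleGraph V} {s t : V} {m : ℕ} {E : Fin m → M.Walk s t}

lemma getVert_eq_getVert_iff (hpath : ∀ i, (E i).IsPath)
    (hdisj : ∀ i j, i ≠ j → ∀ x, x ∈ (E i).support → x ∈ (E j).support → x = s ∨ x = t)
    {i j : Fin m} {a b : ℕ} (ha : a ≤ (E i).length) (hb : b ≤ (E j).length) :
    (E i).getVert a = (E j).getVert b ↔
      i = j ∧ a = b ∨ a = 0 ∧ b = 0 ∨ a = (E i).length ∧ b = (E j).length := by
  constructor
  · intro h
    by_cases hij : i = j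
    · subst hij
      exact Or.inl ⟨rfl, (hpath i).getVert_injOn ha hb h⟩
    · rcases hdisj i j hij _ ((E i).getVert_mem_support a)
        (h ▸ (E j).getVert_mem_support b) with h' | h'
      · exact Or.inr (Or.inl ⟨((hpath i).getVert_eq_start_iff ha).1 h',
          ((hpath j).getVert_eq_start_iff hb).1 (h ▸ h')⟩)
      · exact Or.inr (Or.inr ⟨((hpath i).getVert_eq_end_iff ha).1 h',
          ((hpath j).getVert_eq_end_iff hb).1 (h ▸ h')⟩)
  · rintro (⟨rfl, rfl⟩ | ⟨rfl, rfl⟩ | ⟨rfl, rfl⟩) <;> simp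

/-- The label of the edge number `a` of the path `i`. -/
def edgeLabel {I : Type*} (n : I → ℕ) (i : I) (a : ℕ) : EdgeLabel I :=
  if n i = 1 then .only else if a = 0 then .first i else if a + 1 = n i then .last i else .inner i a

lemma edgeLabel_inj {I : Type*} {n : I → ℕ} (hone : ∀ i j, n i = 1 → n j = 1 → i = j) {i j : I}
    {a b : ℕ} (ha : a < n i) (hb : b < n j) (h : edgeLabel n i a = edgeLabel n j b) :
    i = j ∧ a = b := by
  unfold edgeLabel at h
  grind

lemma edgeLabel_meet_iff {I : Type*} {n : I → ℕ} (hone : ∀ i j, n i = 1 → n j = 1 → i = j)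
    {i j : I} {a b : ℕ} (ha : a < n i) (hb : b < n j) (hab : ¬ (i = j ∧ a = b)) :
    EdgeLabel.Meet n (edgeLabel n i a) (edgeLabel n j b) ↔
      i = j ∧ (a + 1 = b ∨ b + 1 = a) ∨ a = 0 ∧ b = 0 ∨ a + 1 = n i ∧ b + 1 = n j := by
  unfold edgeLabel
  split_ifs <;> simp only [EdgeLabel.Meet] <;> grind

lemma edgeLabel_valid {I : Type*} {n : I → ℕ} {p : Prop} (hp : ∀ i, n i = 1 → p) {i : I} {a : ℕ}
    (ha : a < n i) : (edgeLabel n i a).Valid n p := by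
  unfold edgeLabel
  split_ifs <;> simp only [EdgeLabel.Valid] <;> grind

/-- The line graph of a union of internally disjoint paths is word-representable if there are
suitable orders on the paths. -/
theorem wordRepresentable_lineGraph_of_pathOrder {p : Prop}
    (P : PathOrder (fun i => (E i).length) p) (hp : ∀ i, (E i).length = 1 → p)
    (hpath : ∀ i, (E i).IsPath) (hinj : Function.Injective E)
    (hdisj : ∀ i j, i ≠ j → ∀ x, x ∈ (E i).support → x ∈ (E j).support → x = s ∨ x = t)
    (hedge : ∀ e ∈ M.edgeSet, ∃ i, e ∈ (E i).edges) : WordRepresentable M.lineGraph := by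
  have hfin : Finite M.edgeSet := by
    refine ((Set.finite_iUnion fun i => (E i).edges.finite_toSet).subset
      fun e he => Set.mem_iUnion.2 (hedge e he) : M.edgeSet.Finite)
  have hex : ∀ e : M.edgeSet, ∃ i, ∃ a < (E i).length,
      e.1 = s((E i).getVert a, (E i).getVert (a + 1)) := by
    rintro ⟨e, he⟩
    obtain ⟨i, hi⟩ := hedge e he
    induction e using Sym2.ind with
    | _ x y =>
      obtain ⟨a, ha, h⟩ := (E i).mk_mem_edges_iff_exists.1 hi
      exact ⟨i, a, ha, h.symm⟩
  choose I a ha hIa using hex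
  -- A path of length one is determined by its ends, so only one edge gets the label `only`.
  have hone : ∀ i j, (E i).length = 1 → (E j).length = 1 → i = j := by
    intro i j hi hj
    refine hinj (Walk.ext_getVert_le_length (hi.trans hj.symm) fun k hk => ?_)
    rw [getVert_eq_getVert_iff hpath hdisj hk (by omega)]
    omega
  have hne : ∀ e e', e ≠ e' → ¬ (I e = I e' ∧ a e = a e') := by
    rintro e e' h ⟨h1, h2⟩
    exact h (Subtype.ext (by rw [hIa, hIa, h1, h2]))
  refine EdgeLabel.wordRepresentable P (fun e => edgeLabel (fun i => (E i).length) (I e) (a e))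
    (fun e e' h => ?_) (fun e => edgeLabel_valid hp (ha e)) fun e e' h => ?_
  · by_contra hn
    exact hne e e' hn (edgeLabel_inj hone (ha e) (ha e') h)
  · rw [edgeLabel_meet_iff hone (ha e) (ha e') (hne e e' h), lineGraph_adj_iff_exists, hIa e, hIa e']
    have h1 := ha e
    have h2 := ha e'
    have h3 := hne e e' h
    have hor : ∀ x y z w : V, (∃ v, v ∈ s(x, y) ∧ v ∈ s(z, w)) ↔
        x = z ∨ x = w ∨ y = z ∨ y = w := by
      intro x y z w; simp; tauto
    rw [hor]
    have hgv := fun c d => getVert_eq_getVert_iff hpath hdisj (i := I e) (j := I e')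
      (a := c) (b := d)
    rw [hgv _ _ (by omega) (by omega), hgv _ _ (by omega) (by omega), hgv _ _ (by omega) (by omega),
      hgv _ _ (by omega) (by omega)]
    simp only [ne_eq, h, not_false_eq_true, true_and]
    grind

/-- A path of length one and three paths of length two with the same ends, internally disjoint,
that cover the graph together with other such paths, yield an induced book of three triangles. -/
lemma triangularBook_isIndContained (hst : s ≠ t) (hpath : ∀ i, (E i).IsPath)
    (hdisj : ∀ i j, i ≠ j → ∀ x, x ∈ (E i).support → x ∈ (E j).support → x = s ∨ x = t)
    (hedge : ∀ e ∈ M.edgeSet, ∃ i, e ∈ (E i).edges) (hadj : M.Adj s t) {k : ℕ} (f : Fin k → Fin m)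
    (hf : Function.Injective f) (htwo : ∀ l, (E (f l)).length = 2) :
    (triangularBook k).IsIndContained M := by
  have hs : ∀ l, (E (f l)).getVert 1 ≠ s := fun l h => by
    have := ((hpath (f l)).getVert_eq_start_iff (by rw [htwo]; omega)).1 h
    omega
  have ht : ∀ l, (E (f l)).getVert 1 ≠ t := fun l h => by
    have := ((hpath (f l)).getVert_eq_end_iff (by rw [htwo]; omega)).1 h
    have := htwo l
    omega
  have has : ∀ l, M.Adj s ((E (f l)).getVert 1) := fun l => by
    simpa using (E (f l)).adj_getVert_succ (i := 0) (by rw [htwo]; omega)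
  have hat : ∀ l, M.Adj ((E (f l)).getVert 1) t := fun l => by
    have h := (E (f l)).adj_getVert_succ (i := 1) (by rw [htwo]; omega)
    rwa [(E (f l)).getVert_of_length_le (i := 1 + 1) (by rw [htwo])] at h
  have hmem : ∀ l i, (E (f l)).getVert 1 ∈ (E i).support → f l = i := fun l i h => by
    by_contra hn
    exact (hdisj _ _ hn _ ((E (f l)).getVert_mem_support 1) h).elim (hs l) (ht l)
  -- An edge between two middle vertices would lie on some path, but each middle vertex is on a
  -- single path.
  have hnadj : ∀ l l', ¬ M.Adj ((E (f l)).getVert 1) ((E (f l')).getVert 1) := fun l l' h => by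
    obtain ⟨i, hi⟩ := hedge _ ((M.mem_edgeSet).2 h)
    obtain rfl := hf ((hmem l i (Walk.fst_mem_support_of_mem_edges _ hi)).trans
      (hmem l' i (Walk.snd_mem_support_of_mem_edges _ hi)).symm)
    exact h.ne rfl
  have hinj : ∀ l l', (E (f l)).getVert 1 = (E (f l')).getVert 1 ↔ l = l' := fun l l' =>
    ⟨fun h => hf (hmem l _ (h ▸ Walk.getVert_mem_support _ 1)), fun h => h ▸ rfl⟩
  let g : Fin 2 ⊕ Fin k → V := Sum.elim ![s, t] fun l => (E (f l)).getVert 1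
  have hg : Function.Injective g := by
    rintro (x | x) (y | y) h
    · fin_cases x <;> fin_cases y <;> simp_all [g, eq_comm]
    · fin_cases x <;> simp [g] at h
      exacts [(hs y h.symm).elim, (ht y h.symm).elim]
    · fin_cases y <;> simp [g] at h
      exacts [(hs x h).elim, (ht x h).elim]
    · rw [(hinj x y).1 h]
  have hga : ∀ x y, M.Adj (g x) (g y) ↔ (triangularBook k).Adj x y := by
    rintro (x | x) (y | y)
    · fin_cases x <;> fin_cases y <;> simp [g, triangularBook_adj, hadj, hadj.symm]
    · fin_cases x <;> simp [g, triangularBook_adj, has, (hat _).symm]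
    · fin_cases y <;> simp [g, triangularBook_adj, hat, (has _).symm]
    · simp [g, triangularBook_adj, hnadj]
  exact ⟨⟨⟨g, hg⟩, hga _ _⟩⟩

end Melon

/-- The line graph of a melon graph without an induced book of three triangles is
word-representable. -/
theorem IsMelon.wordRepresentable_lineGraph {V : Type*} {M : SimpleGraph V} (hM : IsMelon M)
    (h : ¬ (triangularBook 3).IsIndContained M) : WordRepresentable M.lineGraph := by
  obtain ⟨s, t, m, E, hst, -, hpath, hinj, hdisj, -, hedge⟩ := hM
  by_cases hone : ∃ i, (E i).length = 1
  · obtain ⟨i₀, hi₀⟩ := hone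
    have hthree : ∀ i j k, (E i).length = 2 → (E j).length = 2 → (E k).length = 2 → i < j →
        ¬ j < k := by
      intro i j k hi hj hk hij hjk
      refine h (triangularBook_isIndContained hst hpath hdisj hedge (Walk.adj_of_length_eq_one hi₀)
        ![i, j, k] ?_ ?_)
      · intro x y hxy
        fin_cases x <;> fin_cases y <;> simp at hxy ⊢ <;> omega
      · intro l
        fin_cases l <;> assumption
    -- `Q` selects the path of length two with the least index, `R` any later one; `hthree` makes
    -- the latter unique.
    refine wordRepresentable_lineGraph_of_pathOrder (PathOrder.ofTwo _
      (fun i => (E i).length = 2 ∧ ∀ j < i, (E j).length ≠ 2)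
      (fun i => (E i).length = 2 ∧ ∃ j < i, (E j).length = 2) ?_ ?_ ?_ ?_) (fun _ _ => trivial)
      hpath hinj hdisj hedge
    · rintro i j ⟨hi, hi'⟩ ⟨hj, hj'⟩
      exact le_antisymm (not_lt.1 fun hl => hi' j hl hj) (not_lt.1 fun hl => hj' i hl hi)
    · rintro i j ⟨hi, i', hi', hi''⟩ ⟨hj, j', hj', hj''⟩
      exact le_antisymm (not_lt.1 (hthree j' j i hj'' hj hi hj'))
        (not_lt.1 (hthree i' i j hi'' hi hj hi'))
    · rintro i ⟨-, hi⟩ ⟨-, j, hj, hj'⟩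
      exact hi j hj hj'
    · intro i
      grind
  · push Not at hone
    exact wordRepresentable_lineGraph_of_pathOrder (PathOrder.ofNotOnly _)
      (fun i hi => hone i hi) hpath hinj hdisj hedge

end WordMelon

theorem theorem4p5 {V : Type*} (M : SimpleGraph V) (hM : WordMelon.IsMelon M) :
    WordMelon.WordRepresentable M.lineGraph ↔
      ¬ (WordMelon.triangularBook 3).IsIndContained M :=
  ⟨fun h h' => WordMelon.not_wordRepresentable_lineGraph h' h, hM.wordRepresentable_lineGraph⟩
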